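/- Let $L$ be a finite geometric lattice, that is, a finite lattice in which every element is a join of points (elements covering $0$; the empty join is $0$), and which is semimodular: whenever $a$ covers $a\wedge b$, the join $a\vee b$ covers $b$. Let the rank (height) of an element $x$ be the maximum length of a chain ending at $x$, let $d$ be the rank of $1$ (the rank of $L$), and let $W_k(L)$ be the number of elements of $L$ of rank $k$. Then \[ W_1(L)\le W_i(L)\qquad\text{for all integers } i \text{ with } 1\le i\le d-1, \] and if $W_1(L)=W_i(L)$ for some integer $i$ with $2\le i\le d-1$, then $i=d-1$. -/

import Mathlib

/-- A geometric lattice (with `0 = ⊥` and `1 = ⊤`): a semimodular point lattice, that is, if `a`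
covers `a ⊓ b` then `a ⊔ b` covers `b`, and every element is the join of a set of points
(the element `⊥` being the join of the empty set). -/
class IsGeometricLattice (L : Type*) [Lattice L] [BoundedOrder L] : Prop
    extends IsUpperModularLattice L, IsAtomistic L

/-- `levelNumber L k` is `W_k(L)`, the number of elements of height (rank) `k`, the height of `x`
being the maximum length of a chain ending at `x`. -/
noncomputable def levelNumber (L : Type*) [Lattice L] (k : ℕ) : ℕ :=
  {x : L | Order.height x = (k : ℕ∞)}.ncard

open Finset

/-! The argument is Conway's weighting proof of de Bruijn–Erdős, run by induction on the level over
all upper intervals `[a, ⊤]`. Points are the covers of `a`, blocks the elements of a higher level.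
The weighting (`exists_not_rel_card_mul_le`) gives `p ≰ x` with `|P| * deg p ≤ |B| * deg x`.
Induction in `[p, ⊤]` bounds `deg p` below by the number `c` of covers of `p`, and `q ↦ q ⊔ p`
embeds the points under `x` into these covers, so `deg x ≤ c`. Hence `|P| ≤ |B|`. When `x` has
corank at least 2 the embedding is not onto, so the inequality is strict. -/

/-- If every point misses a block and every block misses a point, then some non-incident pair
`(p, x)` satisfies `|P| * deg p ≤ |B| * deg x`. -/
theorem exists_not_rel_card_mul_le {α β : Type*} (P : Finset α) (B : Finset β) (I : α → β → Prop)
    [∀ p x, Decidable (I p x)] (hP : ∀ p ∈ P, ∃ x ∈ B, ¬ I p x)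
    (hB : ∀ x ∈ B, ∃ p ∈ P, ¬ I p x) (hne : P.Nonempty) :
    ∃ p ∈ P, ∃ x ∈ B, ¬ I p x ∧
      #P * #(B.filter fun x => I p x) ≤ #B * #(P.filter fun p => I p x) := by
  by_contra! hlt
  set d : α → ℚ := fun p => #(B.filter fun x => I p x) with hd
  set e : β → ℚ := fun x => #(P.filter fun p => I p x) with he
  have hdn : ∀ p, (#(B.filter fun x => ¬ I p x) : ℚ) = #B - d p := fun p => by
    rw [← card_filter_add_card_filter_not (s := B) (fun x => I p x)]; simp [hd]
  have hen : ∀ x, (#(P.filter fun p => ¬ I p x) : ℚ) = #P - e x := fun x => by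
    rw [← card_filter_add_card_filter_not (s := P) (fun p => I p x)]; simp [he]
  have hdpos : ∀ p ∈ P, (0 : ℚ) < #B - d p := fun p hp => by
    obtain ⟨x, hx, hI⟩ := hP p hp
    rw [← hdn]
    exact_mod_cast card_pos.2 ⟨x, by simp [hx, hI]⟩
  have hepos : ∀ x ∈ B, (0 : ℚ) < #P - e x := fun x hx => by
    obtain ⟨p, hp, hI⟩ := hB x hx
    rw [← hen]
    exact_mod_cast card_pos.2 ⟨p, by simp [hp, hI]⟩
  have hsum : ∑ p ∈ P, d p = ∑ x ∈ B, e x := by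
    simp only [hd, he]
    exact_mod_cast sum_card_bipartiteAbove_eq_sum_card_bipartiteBelow (s := P) (t := B) I
  -- Each `d p` is spread evenly over the blocks missing `p`, and below each `e x` over the points
  -- off `x`, so both totals run over the same non-incident pairs.
  have h1 : ∑ p ∈ P, d p = ∑ p ∈ P, ∑ x ∈ B with ¬ I p x, d p / (#B - d p) :=
    sum_congr rfl fun p hp => by
      rw [sum_const, nsmul_eq_mul, hdn, mul_div_cancel₀ _ (hdpos p hp).ne']
  have h2 : ∑ x ∈ B, e x = ∑ p ∈ P, ∑ x ∈ B with ¬ I p x, e x / (#P - e x) := by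
    calc ∑ x ∈ B, e x = ∑ x ∈ B, ∑ p ∈ P with ¬ I p x, e x / (#P - e x) :=
          sum_congr rfl fun x hx => by
            rw [sum_const, nsmul_eq_mul, hen, mul_div_cancel₀ _ (hepos x hx).ne']
      _ = _ := by simp only [sum_filter]; exact sum_comm
  have h3 : ∑ p ∈ P, ∑ x ∈ B with ¬ I p x, e x / (#P - e x) <
      ∑ p ∈ P, ∑ x ∈ B with ¬ I p x, d p / (#B - d p) := by
    refine sum_lt_sum_of_nonempty hne fun p hp => ?_
    obtain ⟨y, hy, hyI⟩ := hP p hp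
    refine sum_lt_sum_of_nonempty ⟨y, by simp [hy, hyI]⟩ fun x hx => ?_
    rw [mem_filter] at hx
    -- After cross-multiplying, the terms `d p * e x` cancel, leaving the assumed inequality.
    rw [div_lt_div_iff₀ (hepos x hx.1) (hdpos p hp)]
    have : (#B * e x : ℚ) < #P * d p := by
      simp only [hd, he]
      exact_mod_cast hlt p hp x hx.1 hx.2
    linarith
  linarith

/-! ### Rank in finite semimodular lattices -/

section Height

variable {L : Type*} [Lattice L] [Finite L]

/-- A third lower cover `t = v ⊔ s` of `y` is interposed. It shares the lower cover `s` with `x`, so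
`x` and `t` have equal height; and `t ⊓ u` lies strictly above `m`, so induction upward on the meet
handles `t` and `u`. -/
theorem height_eq_of_covBy_of_covBy [IsUpperModularLattice L] {y : L}
    (ih : ∀ z < y, ∀ x, x ⋖ z → Order.height z = Order.height x + 1) :
    ∀ {m x u : L}, x ⊓ u = m → x ⋖ y → u ⋖ y → Order.height x = Order.height u := by
  intro m
  induction m using WellFoundedGT.induction with
  | ind m ihm =>
    intro x u hm hx hu
    by_cases hxu : x = u
    · rw [hxu]
    have hmx : m < x := lt_of_le_of_ne (hm ▸ inf_le_left) fun h =>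
      hx.2 (lt_of_le_of_ne (inf_eq_left.1 (hm.trans h)) hxu) hu.lt
    have hmu : m < u := lt_of_le_of_ne (hm ▸ inf_le_right) fun h =>
      hu.2 (lt_of_le_of_ne (inf_eq_right.1 (hm.trans h)) (Ne.symm hxu)) hx.lt
    obtain ⟨v, hmv, hvu⟩ := exists_covBy_le_of_lt hmu
    obtain ⟨s, hms, hsx⟩ := exists_le_covBy_of_lt hmx
    have hvx : ¬ v ≤ x := fun h => hmv.lt.not_ge (hm ▸ le_inf h hvu)
    have hvs : v ⊓ s = m := (hmv.eq_or_eq (le_inf hmv.le hms) inf_le_left).resolve_right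
      fun h => hvx ((inf_eq_left.1 h).trans hsx.le)
    have hst : s ⋖ v ⊔ s := covBy_sup_of_inf_covBy_left (hvs ▸ hmv)
    have hty : v ⊔ s ≤ y := sup_le (hvu.trans hu.le) (hsx.le.trans hx.le)
    have hxt : x ⊓ (v ⊔ s) = s :=
      (hst.eq_or_eq (le_inf hsx.le le_sup_right) inf_le_right).resolve_right
      fun h => hvx (le_sup_left.trans (inf_eq_right.1 h))
    have hsup : x ⊔ (v ⊔ s) = y :=
      (hx.eq_or_eq le_sup_left (sup_le hx.le hty)).resolve_left
      fun h => hvx (le_sup_left.trans (sup_eq_left.1 h))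
    have ht : v ⊔ s ⋖ y := hsup ▸ covBy_sup_of_inf_covBy_left (hxt.symm ▸ hsx)
    rw [ih x hx.lt s hsx, ← ih _ ht.lt s hst]
    exact ihm _ (hmv.lt.trans_le (le_inf le_sup_left hvu)) rfl ht hu

theorem CovBy.height_eq_add_one [IsUpperModularLattice L] {x y : L} (h : x ⋖ y) :
    Order.height y = Order.height x + 1 := by
  induction y using WellFoundedLT.induction generalizing x with
  | ind y ih =>
    refine le_antisymm ?_ (Order.height_add_one_le h.lt)
    rw [Order.height_eq_iSup_lt_height]
    refine iSup₂_le fun u hu => ?_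
    obtain ⟨v, huv, hvy⟩ := exists_le_covBy_of_lt hu
    rw [height_eq_of_covBy_of_covBy (fun z hz x hx => ih z hz hx) rfl h hvy]
    gcongr

/-- The height of an element of a finite lattice, as a natural number. -/
noncomputable def natHeight (x : L) : ℕ := (Order.height x).toNat

theorem coe_natHeight (x : L) : (natHeight x : ℕ∞) = Order.height x := by
  have := Fintype.ofFinite L
  have h : Order.height x ≤ Fintype.card L :=
    Order.height_le fun p _ => by exact_mod_cast (LTSeries.length_lt_card p).le
  exact ENat.natCast_toNat (h.trans_lt (ENat.natCast_lt_top _)).ne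

theorem natHeight_strictMono : StrictMono (natHeight : L → ℕ) := fun x y h => by
  have := Order.height_add_one_le h
  rw [← coe_natHeight, ← coe_natHeight] at this
  exact_mod_cast this

theorem CovBy.natHeight_eq_add_one [IsUpperModularLattice L] {x y : L} (h : x ⋖ y) :
    natHeight y = natHeight x + 1 := by
  have := h.height_eq_add_one
  rw [← coe_natHeight, ← coe_natHeight] at this
  exact_mod_cast this

theorem covBy_iff_natHeight [IsUpperModularLattice L] {x y : L} :
    x ⋖ y ↔ x ≤ y ∧ natHeight y = natHeight x + 1 := by
  refine ⟨fun h => ⟨h.le, h.natHeight_eq_add_one⟩, fun ⟨hle, h⟩ => ⟨?_, fun z hxz hzy => ?_⟩⟩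
  · exact hle.lt_of_ne fun e => by subst e; omega
  · have := natHeight_strictMono hxz
    have := natHeight_strictMono hzy
    omega

end Height

theorem CovBy.covBy_sup_of_not_le {L : Type*} [Lattice L] [IsUpperModularLattice L] {a p x : L}
    (hp : a ⋖ p) (hx : a ≤ x) (hpx : ¬ p ≤ x) : x ⋖ p ⊔ x := by
  have : p ⊓ x = a := (hp.eq_or_eq (le_inf hp.le hx) inf_le_left).resolve_right
    fun h => hpx (inf_eq_left.1 h)
  exact covBy_sup_of_inf_covBy_left (this.symm ▸ hp)

/-! ### Avoiding a given point -/

section Geometric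

variable {L : Type*} [Lattice L] [BoundedOrder L]

theorem exists_isAtom_not_le [IsAtomistic L] {x : L} (hx : x ≠ ⊤) : ∃ q : L, IsAtom q ∧ ¬ q ≤ x := by
  by_contra! h
  obtain ⟨s, hs, hatom⟩ := IsAtomistic.isLUB_atoms (⊤ : L)
  exact hx (top_le_iff.1 (hs.2 fun q hq => h q (hatom q hq)))

theorem exists_covBy_not_le [IsGeometricLattice L] {a x : L} (hax : a ≤ x) (hx : x ≠ ⊤) :
    ∃ q : L, a ⋖ q ∧ ¬ q ≤ x := by
  obtain ⟨q, hq, hqx⟩ := exists_isAtom_not_le hx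
  exact ⟨q ⊔ a, hq.bot_covBy.covBy_sup_of_not_le bot_le fun h => hqx (h.trans hax),
    fun h => hqx (le_sup_left.trans h)⟩

variable [Finite L] [IsGeometricLattice L]

omit [IsGeometricLattice L] in
theorem natHeight_lt_top_iff {x : L} : natHeight x < natHeight (⊤ : L) ↔ x ≠ ⊤ :=
  ⟨fun h e => by simp [e] at h, fun h => natHeight_strictMono (lt_top_iff_ne_top.2 h)⟩

theorem exists_natHeight_eq_not_le {a p : L} (hp : a ⋖ p) :
    ∀ k : ℕ, natHeight a + k < natHeight (⊤ : L) →
      ∃ x, a ≤ x ∧ natHeight x = natHeight a + k ∧ ¬ p ≤ x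
  | 0, _ => ⟨a, le_rfl, rfl, hp.lt.not_ge⟩
  | k + 1, hk => by
    obtain ⟨x, hax, hx, hpx⟩ := exists_natHeight_eq_not_le hp k (by omega)
    have hpxc := hp.covBy_sup_of_not_le hax hpx
    have hne : p ⊔ x ≠ ⊤ := natHeight_lt_top_iff.1 (by rw [hpxc.natHeight_eq_add_one]; omega)
    -- A cover `q` of `x` above `p` could only be `p ⊔ x`, so any cover not below `p ⊔ x` avoids
    -- `p`.
    obtain ⟨q, hq, hqx⟩ := exists_covBy_not_le (le_sup_right : x ≤ p ⊔ x) hne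
    refine ⟨q, hax.trans hq.le, by rw [hq.natHeight_eq_add_one]; omega, fun hpq => hqx ?_⟩
    exact ((hq.eq_or_eq hpxc.le (sup_le hpq hq.le)).resolve_left hpxc.ne').ge

end Geometric

/-! ### Comparing levels of upper intervals -/

section Levels

variable {L : Type*} [Lattice L] [BoundedOrder L] [Fintype L] [IsGeometricLattice L]

open Classical in
/-- The elements above `a` whose height exceeds that of `a` by `k`. -/
noncomputable def upperLevel (a : L) (k : ℕ) : Finset L :=
  {x | a ≤ x ∧ natHeight x = natHeight a + k}

omit [BoundedOrder L] [IsGeometricLattice L] in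
theorem mem_upperLevel {a x : L} {k : ℕ} :
    x ∈ upperLevel a k ↔ a ≤ x ∧ natHeight x = natHeight a + k := by
  simp [upperLevel]

theorem mem_upperLevel_one {a p : L} : p ∈ upperLevel a 1 ↔ a ⋖ p := by
  rw [mem_upperLevel, covBy_iff_natHeight]

-- The inverse is `r ↦ r ⊓ x`: since `q ⊔ p` covers `q` and is not below `x`, its meet with `x` is
-- `q`.
open Classical in
theorem injOn_sup_upperLevel {a p x : L} (hp : a ⋖ p) (hpx : ¬ p ≤ x) :
    Set.InjOn (fun q => q ⊔ p) ({q ∈ upperLevel a 1 | q ≤ x} : Finset L) := by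
  have key : ∀ q, a ⋖ q → q ≤ x → (q ⊔ p) ⊓ x = q := fun q hq hqx => by
    have hc : q ⋖ q ⊔ p := by
      rw [sup_comm]
      exact hp.covBy_sup_of_not_le hq.le fun h => hpx (h.trans hqx)
    exact (hc.eq_or_eq (le_inf le_sup_left hqx) inf_le_left).resolve_right
      fun h => hpx (le_sup_right.trans (inf_eq_left.1 h))
  intro q hq r hr h
  simp only [coe_filter, Set.mem_ofPred_eq, mem_upperLevel_one] at hq hr
  simp only at h
  rw [← key q hq.1 hq.2, h, key r hr.1 hr.2]

open Classical in
theorem mapsTo_sup_upperLevel {a p x : L} (hp : a ⋖ p) (hpx : ¬ p ≤ x) :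
    Set.MapsTo (fun q => q ⊔ p) ({q ∈ upperLevel a 1 | q ≤ x} : Finset L) (upperLevel p 1) := by
  intro q hq
  simp only [coe_filter, Set.mem_ofPred_eq, mem_upperLevel_one] at hq
  rw [mem_coe, mem_upperLevel_one]
  refine hq.1.covBy_sup_of_not_le hp.le fun h => hpx ?_
  exact ((hp.eq_or_eq hq.1.le h).resolve_left hq.1.ne').ge.trans hq.2

open Classical in
theorem card_upperLevel_le {a p x : L} (hp : a ⋖ p) (hpx : ¬ p ≤ x) :
    #{q ∈ upperLevel a 1 | q ≤ x} ≤ #(upperLevel p 1) :=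
  card_le_card_of_injOn _ (mapsTo_sup_upperLevel hp hpx) (injOn_sup_upperLevel hp hpx)

-- The image of `q ↦ q ⊔ p` lies below `p ⊔ x ≠ ⊤`, so it misses some cover of `p`.
open Classical in
theorem card_upperLevel_lt {a p x : L} (hp : a ⋖ p) (hax : a ≤ x) (hpx : ¬ p ≤ x)
    (hx : natHeight x + 1 < natHeight (⊤ : L)) :
    #{q ∈ upperLevel a 1 | q ≤ x} < #(upperLevel p 1) := by
  rw [← card_image_of_injOn (injOn_sup_upperLevel hp hpx)]
  have hne : p ⊔ x ≠ ⊤ := natHeight_lt_top_iff.1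
    (by rwa [(hp.covBy_sup_of_not_le hax hpx).natHeight_eq_add_one])
  obtain ⟨l, hl, hlx⟩ := exists_covBy_not_le (le_sup_left : p ≤ p ⊔ x) hne
  refine card_lt_card ((ssubset_iff_of_subset ?_).2 ⟨l, mem_upperLevel_one.2 hl, fun h => ?_⟩)
  · exact image_subset_iff.2 (mapsTo_sup_upperLevel hp hpx)
  · obtain ⟨q, hq, rfl⟩ := mem_image.1 h
    exact hlx (sup_le ((mem_filter.1 hq).2.trans le_sup_right) le_sup_left)

-- Identifies the degree of the point `p` with a level number of `[p, ⊤]`, one step lower, where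
-- induction applies.
open Classical in
theorem filter_upperLevel {a p : L} (hp : a ⋖ p) (k : ℕ) :
    {x ∈ upperLevel a (k + 1) | p ≤ x} = upperLevel p k := by
  ext x
  simp only [mem_filter, mem_upperLevel, hp.natHeight_eq_add_one]
  constructor
  · rintro ⟨⟨_, h⟩, hpx⟩
    exact ⟨hpx, by omega⟩
  · rintro ⟨hpx, h⟩
    exact ⟨⟨hp.le.trans hpx, by omega⟩, hpx⟩

open Classical in
theorem card_upperLevel_one_le_and_lt (k : ℕ) (a : L)
    (hk : natHeight a + (k + 1) < natHeight (⊤ : L)) :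
    #(upperLevel a 1) ≤ #(upperLevel a (k + 1)) ∧
      (1 ≤ k → natHeight a + (k + 2) < natHeight (⊤ : L) →
        #(upperLevel a 1) < #(upperLevel a (k + 1))) := by
  induction k generalizing a with
  | zero => exact ⟨le_rfl, fun h => absurd h (by omega)⟩
  | succ k ih =>
    have hane : a ≠ ⊤ := natHeight_lt_top_iff.1 (by omega)
    obtain ⟨p₀, hp₀, -⟩ := exists_covBy_not_le le_rfl hane
    obtain ⟨p, hp, x, hx, hpx, hle⟩ := exists_not_rel_card_mul_le (upperLevel a 1)
      (upperLevel a (k + 2)) (· ≤ ·)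
      (fun p hp => by
        obtain ⟨x, hax, hx, hpx⟩ := exists_natHeight_eq_not_le (mem_upperLevel_one.1 hp) _ hk
        exact ⟨x, mem_upperLevel.2 ⟨hax, hx⟩, hpx⟩)
      (fun x hx => by
        rw [mem_upperLevel] at hx
        obtain ⟨q, hq, hqx⟩ := exists_covBy_not_le hx.1 (natHeight_lt_top_iff.1 (by omega))
        exact ⟨q, mem_upperLevel_one.2 hq, hqx⟩)
      ⟨p₀, mem_upperLevel_one.2 hp₀⟩
    rw [mem_upperLevel_one] at hp
    rw [mem_upperLevel] at hx
    have hdeg : #(upperLevel p 1) ≤ #(upperLevel p (k + 1)) :=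
      (ih p (by rw [hp.natHeight_eq_add_one]; omega)).1
    rw [filter_upperLevel hp (k + 1)] at hle
    have hpos : 0 < #(upperLevel p 1) := by
      have hpne : p ≠ ⊤ := natHeight_lt_top_iff.1 (by rw [hp.natHeight_eq_add_one]; omega)
      obtain ⟨l, hl, -⟩ := exists_covBy_not_le le_rfl hpne
      exact card_pos.2 ⟨l, mem_upperLevel_one.2 hl⟩
    constructor
    · have := card_upperLevel_le hp hpx
      by_contra! hlt
      nlinarith
    -- Strictness comes from the embedding alone; only the weak inequality is used in `[p, ⊤]`.
    · intro _ hk'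
      have := card_upperLevel_lt hp hx.1 hpx (by omega)
      have hP : 0 < #(upperLevel a 1) := card_pos.2 ⟨p₀, mem_upperLevel_one.2 hp₀⟩
      by_contra! hlt
      nlinarith

omit [IsGeometricLattice L] in
theorem levelNumber_eq_card_upperLevel_bot (k : ℕ) :
    levelNumber L k = #(upperLevel (⊥ : L) k) := by
  have hbot : natHeight (⊥ : L) = 0 := by simp [natHeight]
  rw [levelNumber, ← Set.ncard_coe_finset]
  congr 1
  ext x
  rw [mem_coe, mem_upperLevel, hbot, Set.mem_ofPred_eq, ← coe_natHeight]
  simp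

end Levels

theorem mainTheorem11 {L : Type*} [Lattice L] [BoundedOrder L] [Finite L] [IsGeometricLattice L]
    (d : ℕ) (hd : Order.height (⊤ : L) = (d : ℕ∞)) :
    (∀ i : ℕ, 1 ≤ i → i < d → levelNumber L 1 ≤ levelNumber L i) ∧
    (∀ i : ℕ, 2 ≤ i → i < d → levelNumber L 1 = levelNumber L i → i = d - 1) := by
  have := Fintype.ofFinite L
  have hd' : natHeight (⊤ : L) = d := by simp [natHeight, hd]
  have hbot : natHeight (⊥ : L) = 0 := by simp [natHeight]
  simp only [levelNumber_eq_card_upperLevel_bot]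
  constructor
  · intro i hi hid
    obtain ⟨k, rfl⟩ := Nat.exists_eq_add_of_le' hi
    exact (card_upperLevel_one_le_and_lt k ⊥ (by omega)).1
  · intro i hi hid heq
    obtain ⟨k, rfl⟩ := Nat.exists_eq_add_of_le' (one_le_two.trans hi)
    by_contra hne
    exact ((card_upperLevel_one_le_and_lt k (⊥ : L) (by omega)).2 (by omega) (by omega)).ne heq
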